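/- Let $\mathbb{D}^2=\{(z_1,z_2)\in\mathbb{C}^2: |z_1|\le 1,\ |z_2|\le 1\}$ be the closed bidisc, $\mathbb{T}^2=\{(z_1,z_2): |z_1|=|z_2|=1\}$ the torus, and let $\mathbb{A}^2$ be the bidisc algebra, i.e. the Banach algebra (with the supremum norm) of all complex-valued functions continuous on $\mathbb{D}^2$ and analytic in the open bidisc. Let $p,q\ge 1$ be integers, let $\alpha_1$ be a primitive $p$-th root of unity and $\alpha_2$ a primitive $q$-th root of unity, put $m=\operatorname{lcm}(p,q)$ and $\Phi(z_1,z_2)=(\alpha_1z_1,\alpha_2z_2)$. Let $w\in\mathbb{A}^2$ be arbitrary, let $T:\mathbb{A}^2\to\mathbb{A}^2$ be the weighted composition operator $Tf=w\cdot(f\circ\Phi)$, and let $w_m(t)=w(t)\,w(\Phi(t))\cdots w(\Phi^{m-1}(t))$ for $t \in \mathbb{D}^2$. A bounded operator $S$ on a Banach space is called upper semi-Fredholm if its image is closed and its kernel is finite-dimensional, lower semi-Fredholm if its image has finite codimension, and semi-Fredholm if it is upper or lower semi-Fredholm. Let $\sigma(T)$ be the spectrum of $T$; let $\sigma_{a.p.}(T)$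 be the set of $\lambda\in\mathbb{C}$ for which there are $f_n\in\mathbb{A}^2$ with $\|f_n\|=1$ and $Tf_n-\lambda f_n\to 0$; let $\sigma_{lsf}(T)$ (respectively $\sigma_{sf}(T)$) be the set of $\lambda\in\mathbb{C}$ for which $\lambda I-T$ is not lower semi-Fredholm (respectively not semi-Fredholm). Then \begin{enumerate} \item $\sigma(T)=\sigma_{lsf}(T)=\{\lambda\in\mathbb{C}: \lambda^m=w_m(t)\text{ for some }t\in\mathbb{D}^2\}$; \item $\sigma_{a.p.}(T)=\sigma_{sf}(T)=\{\lambda\in\mathbb{C}: \lambda^m=w_m(t)\text{ for some }t\in\mathbb{T}^2\}$. \end{enumerate} -/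

import Mathlib

open Filter Topology

noncomputable section

namespace Bidisc

/-- The closed unit bidisc `𝔻²`. -/
def closedBidisc : Set (ℂ × ℂ) := {z | ‖z.1‖ ≤ 1 ∧ ‖z.2‖ ≤ 1}

/-- The open unit bidisc `𝕌²`. -/
def openBidisc : Set (ℂ × ℂ) := {z | ‖z.1‖ < 1 ∧ ‖z.2‖ < 1}

/-- The torus `𝕋²`, as a subset of the closed bidisc. -/
def torus : Set closedBidisc := {t | ‖t.1.1‖ = 1 ∧ ‖t.1.2‖ = 1}

instance instCompactSpaceClosedBidisc : CompactSpace closedBidisc := by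
  have h : closedBidisc = Metric.closedBall (0 : ℂ) 1 ×ˢ Metric.closedBall (0 : ℂ) 1 := by
    ext z
    simp [closedBidisc]
  rw [← isCompact_iff_compactSpace, h]
  exact (isCompact_closedBall _ _).prod (isCompact_closedBall _ _)

/-- The bidisc algebra `𝔸²` with the supremum norm: the continuous functions on the closed
bidisc that are holomorphic in the open bidisc. -/
def bidiscAlgebra : Subalgebra ℂ C(closedBidisc, ℂ) where
  carrier := {f | ∃ F : ℂ × ℂ → ℂ, DifferentiableOn ℂ F openBidisc ∧
    ∀ z : closedBidisc, F z = f z}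
  mul_mem' := by
    rintro f g ⟨F, hF, hFf⟩ ⟨G, hG, hGg⟩
    exact ⟨fun z => F z * G z, hF.mul hG, fun z => by simp [hFf, hGg]⟩
  add_mem' := by
    rintro f g ⟨F, hF, hFf⟩ ⟨G, hG, hGg⟩
    exact ⟨fun z => F z + G z, hF.add hG, fun z => by simp [hFf, hGg]⟩
  algebraMap_mem' c := ⟨fun _ => c, differentiableOn_const c, fun _ => by simp⟩

/-- The map `Φ (z₁, z₂) = (α₁ z₁, α₂ z₂)` of the closed bidisc into itself. -/
def rotation (α₁ α₂ : Circle) : C(closedBidisc, closedBidisc) where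
  toFun z := ⟨((α₁ : ℂ) * z.1.1, (α₂ : ℂ) * z.1.2), by
    simpa [closedBidisc, Circle.norm_coe] using z.2⟩
  continuous_toFun := by fun_prop

/-- The composition `f ∘ Φ`, as an element of the bidisc algebra. -/
def compRotation (α₁ α₂ : Circle) (f : bidiscAlgebra) : bidiscAlgebra :=
  ⟨(f : C(closedBidisc, ℂ)).comp (rotation α₁ α₂), by
    obtain ⟨F, hF, hFf⟩ := f.2
    refine ⟨fun z => F ((α₁ : ℂ) * z.1, (α₂ : ℂ) * z.2), ?_, fun z => ?_⟩
    · refine hF.comp (f := fun z : ℂ × ℂ => ((α₁ : ℂ) * z.1, (α₂ : ℂ) * z.2))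
        (Differentiable.differentiableOn (by fun_prop)) ?_
      intro z hz
      simpa [openBidisc, Circle.norm_coe] using hz
    · exact hFf (rotation α₁ α₂ z)⟩

/-- The weighted composition operator `T f = w · (f ∘ Φ)` on the bidisc algebra. -/
def weightedRotation (α₁ α₂ : Circle) (w : bidiscAlgebra) :
    bidiscAlgebra →L[ℂ] bidiscAlgebra :=
  LinearMap.mkContinuous
    { toFun := fun f => w * compRotation α₁ α₂ f
      map_add' := fun f g => by
        ext z
        exact mul_add _ _ _
      map_smul' := fun c f => by
        ext z
        exact mul_left_comm _ _ _ }
    ‖w‖ (fun f => by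
      refine (norm_mul_le _ _).trans (mul_le_mul_of_nonneg_left ?_ (norm_nonneg _))
      refine (ContinuousMap.norm_le _ (norm_nonneg _)).2 fun z => ?_
      exact ContinuousMap.norm_coe_le_norm (f : C(closedBidisc, ℂ)) (rotation α₁ α₂ z))

/-- `w_n (t) = w (t) w (φ t) ⋯ w (φ^{n-1} t)`. -/
def weightProduct {K : Type*} (φ : K → K) (w : K → ℂ) (n : ℕ) (t : K) : ℂ :=
  ∏ k ∈ Finset.range n, w (φ^[k] t)

section Spectra

variable {X : Type*} [NormedAddCommGroup X] [NormedSpace ℂ X]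

/-- Upper semi-Fredholm: closed image and finite-dimensional kernel. -/
def IsUpperSemiFredholm (S : X →L[ℂ] X) : Prop :=
  IsClosed (S.range : Set X) ∧ FiniteDimensional ℂ S.ker

/-- Lower semi-Fredholm: image of finite codimension. -/
def IsLowerSemiFredholm (S : X →L[ℂ] X) : Prop :=
  FiniteDimensional ℂ (X ⧸ S.range)

/-- Semi-Fredholm: upper or lower semi-Fredholm. -/
def IsSemiFredholm (S : X →L[ℂ] X) : Prop :=
  IsUpperSemiFredholm S ∨ IsLowerSemiFredholm S

/-- The approximate point spectrum. -/
def approxPointSpectrum (T : X →L[ℂ] X) : Set ℂ :=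
  {μ | ∃ x : ℕ → X, (∀ n, ‖x n‖ = 1) ∧ Tendsto (fun n => T (x n) - μ • x n) atTop (𝓝 0)}

/-- The lower semi-Fredholm spectrum. -/
def lowerSemiFredholmSpectrum (T : X →L[ℂ] X) : Set ℂ :=
  {μ | ¬ IsLowerSemiFredholm (μ • ContinuousLinearMap.id ℂ X - T)}

/-- The semi-Fredholm spectrum. -/
def semiFredholmSpectrum (T : X →L[ℂ] X) : Set ℂ :=
  {μ | ¬ IsSemiFredholm (μ • ContinuousLinearMap.id ℂ X - T)}

end Spectra

end Bidisc

end

/-!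
Since `Φ` has order `m`, the power `T ^ m` is multiplication by `w_m`, and `μ - T` divides
`μ ^ m - T ^ m`, so everything is governed by the values of the function `h = μ ^ m - w_m`.

If `h` has no zeros on the bidisc, it is invertible and so is `μ - T`. If `h` has no zeros on the
torus, where every element of the algebra attains its maximum modulus, then `μ - T` is bounded
below.

Conversely, let `μ ≠ 0` and suppose that `h` vanishes at a point of the open bidisc off the
coordinate axes. A holomorphic function of two variables has no isolated zeros, so `h` has
infinitely many zeros nearby; as `Φ` acts freely there, they lie on distinct orbits. Composing the
evaluation at each of them with the geometric cofactor of `μ - T` gives linearly independent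
functionals that vanish on the range of `μ - T`, which therefore has infinite codimension. The other
points of the bidisc follow by density, as the set of lower semi-Fredholm operators is open.

If `h` vanishes at a point of the torus, let `g` be a function peaking there. The geometric cofactor
carries the powers of `g` to a bounded sequence that `μ - T` sends to zero. Were `μ - T` upper
semi-Fredholm, a subsequence would converge in norm, but the pointwise limit is discontinuous.
For `μ = 0` the same arguments apply directly to `w`.
-/

noncomputable section

namespace Bidisc

section Cofactor

variable {R A : Type*} [CommRing R] [Ring A] [Algebra R A]

/-- The geometric cofactor `∑ i < m, r ^ (m - 1 - i) • a ^ i` of `r - a` in `r ^ m - a ^ m`. -/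
def cofactor (a : A) (r : R) (m : ℕ) : A :=
  ∑ i ∈ Finset.range m, r ^ (m - 1 - i) • a ^ i

theorem cofactor_eq_geom_sum₂ (a : A) (r : R) (m : ℕ) :
    cofactor a r m = ∑ i ∈ Finset.range m, algebraMap R A r ^ i * a ^ (m - 1 - i) := by
  rw [(Algebra.commute_algebraMap_left r a).geom_sum₂_comm]
  refine Finset.sum_congr rfl fun i _ => ?_
  rw [← map_pow, ← Algebra.commutes, ← Algebra.smul_def]

theorem algebraMap_sub_mul_cofactor (a : A) (r : R) (m : ℕ) :
    (algebraMap R A r - a) * cofactor a r m = algebraMap R A (r ^ m) - a ^ m := by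
  rw [cofactor_eq_geom_sum₂, (Algebra.commute_algebraMap_left r a).mul_geom_sum₂, map_pow]

theorem cofactor_mul_algebraMap_sub (a : A) (r : R) (m : ℕ) :
    cofactor a r m * (algebraMap R A r - a) = algebraMap R A (r ^ m) - a ^ m := by
  rw [cofactor_eq_geom_sum₂, (Algebra.commute_algebraMap_left r a).geom_sum₂_mul, map_pow]

end Cofactor

section LinearAlgebra

variable {K M ι : Type*} [Field K] [AddCommGroup M] [Module K M]

theorem finite_of_linearIndependent_of_le_ker {W : Submodule K M} [FiniteDimensional K (M ⧸ W)]
    {Λ : ι → Module.Dual K M} (hΛ : LinearIndependent K Λ) (hW : ∀ i, W ≤ (Λ i).ker) :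
    Finite ι := by
  have hquot : LinearIndependent K fun i => W.liftQ (Λ i) (hW i) :=
    LinearIndependent.of_comp (W.mkQ.dualMap) hΛ
  exact Set.finite_univ_iff.1 (Set.finite_univ_iff.2 hquot.finite)

theorem linearIndependent_of_sub_smul_mem_span {v : ι → M} (hv : LinearIndependent K v)
    {s : Set ι} {u : s → M} {c : s → K} (hc : ∀ i, c i ≠ 0)
    (hu : ∀ i, u i - c i • v i ∈ Submodule.span K (v '' sᶜ)) : LinearIndependent K u := by
  set N := Submodule.span K (v '' sᶜ)
  have hmod : LinearIndependent K fun i : s => N.mkQ (v i) :=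
    (hv.comp _ Subtype.val_injective).map <| by
      rw [Submodule.ker_mkQ, Set.range_comp, Subtype.range_coe]
      exact hv.disjoint_span_image disjoint_compl_right
  refine LinearIndependent.of_comp N.mkQ ?_
  convert! hmod.units_smul fun i => Units.mk0 (c i) (hc i) using 1
  ext i
  rw [Function.comp_apply, ← sub_eq_zero, Pi.smul_apply', Units.smul_mk0, ← map_smul, ← map_sub]
  exact (Submodule.Quotient.mk_eq_zero N).2 (hu i)

end LinearAlgebra

section SurjectiveOperators

variable {𝕜 X Y : Type*} [NontriviallyNormedField 𝕜]
  [NormedAddCommGroup X] [NormedSpace 𝕜 X] [CompleteSpace X]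
  [NormedAddCommGroup Y] [NormedSpace 𝕜 Y] [CompleteSpace Y]

theorem eventually_surjective {S : X →L[𝕜] Y} (hS : Function.Surjective S) :
    ∀ᶠ S' : X →L[𝕜] Y in 𝓝 S, Function.Surjective S' := by
  obtain ⟨g, hg⟩ := S.exists_nonlinearRightInverse_of_surjective (LinearMap.range_eq_top.2 hS)
  filter_upwards [eventually_nnnorm_sub_lt S (inv_pos.2 hg)] with S' hS'
  have happrox : ApproximatesLinearOn S' S Set.univ ‖S' - S‖₊ :=
    LipschitzOnWith.approximatesLinearOn (S' - S).lipschitz.lipschitzOnWith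
  have hopen : IsOpen (S'.range : Set Y) := by
    rw [LinearMap.coe_range, ← Set.image_univ]
    exact happrox.open_image g isOpen_univ (.inr hS')
  exact LinearMap.range_eq_top.1 <| S'.range.eq_top_of_nonempty_interior'
    ⟨0, hopen.interior_eq.symm ▸ S'.range.zero_mem⟩

end SurjectiveOperators

section Spectra

variable {X : Type*} [NormedAddCommGroup X] [NormedSpace ℂ X]

theorem isLowerSemiFredholm_of_surjective {S : X →L[ℂ] X} (hS : Function.Surjective S) :
    IsLowerSemiFredholm S := by
  rw [IsLowerSemiFredholm, LinearMap.range_eq_top.2 hS]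
  infer_instance

theorem lowerSemiFredholmSpectrum_subset_spectrum (T : X →L[ℂ] X) :
    lowerSemiFredholmSpectrum T ⊆ spectrum ℂ T := by
  intro μ hμ hunit
  obtain ⟨R, hR⟩ := IsUnit.exists_right_inv hunit
  exact hμ (isLowerSemiFredholm_of_surjective fun x => ⟨R x, DFunLike.congr_fun hR x⟩)

theorem notMem_approxPointSpectrum_iff {T : X →L[ℂ] X} {μ : ℂ} :
    μ ∉ approxPointSpectrum T ↔
      ∃ K, AntilipschitzWith K (μ • ContinuousLinearMap.id ℂ X - T) := by
  set S := μ • ContinuousLinearMap.id ℂ X - T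
  have hnorm (x : X) : ‖T x - μ • x‖ = ‖S x‖ := norm_sub_rev _ _
  constructor
  · contrapose!
    intro hK
    have hsmall (n : ℕ) : ∃ x : X, ‖x‖ = 1 ∧ ‖S x‖ ≤ 1 / (n + 1) := by
      obtain ⟨x, hx⟩ : ∃ x, ((n + 1 : NNReal) : ℝ) * ‖S x‖ < ‖x‖ := by
        by_contra! h
        exact hK _ (S.antilipschitz_of_bound h)
      have hx0 : 0 < ‖x‖ := (by positivity : (0 : ℝ) ≤ _).trans_lt hx
      refine ⟨(‖x‖⁻¹ : ℂ) • x, by simp [norm_smul, hx0.ne'], ?_⟩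
      rw [map_smul, norm_smul, norm_inv, Complex.norm_real, norm_norm, inv_mul_le_iff₀ hx0,
        mul_one_div, le_div_iff₀' (by positivity)]
      exact_mod_cast hx.le
    choose x hx hSx using hsmall
    refine ⟨x, hx, squeeze_zero_norm (fun n => ?_) tendsto_one_div_add_atTop_nhds_zero_nat⟩
    exact (hnorm (x n)).trans_le (hSx n)
  · rintro ⟨K, hK⟩ ⟨x, hx, hlim⟩
    have hlimK : Tendsto (fun n => K * ‖S (x n)‖) atTop (𝓝 0) := by
      simpa [hnorm] using hlim.norm.const_mul (K : ℝ)
    refine (ge_of_tendsto' hlimK fun n => ?_).not_gt one_pos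
    exact (hx n).symm.trans_le (S.bound_of_antilipschitz hK (x n))

theorem semiFredholmSpectrum_subset_approxPointSpectrum [CompleteSpace X] (T : X →L[ℂ] X) :
    semiFredholmSpectrum T ⊆ approxPointSpectrum T := by
  intro μ hμ
  by_contra hap
  obtain ⟨K, hK⟩ := notMem_approxPointSpectrum_iff.1 hap
  refine hμ (.inl ⟨hK.isClosed_range (ContinuousLinearMap.uniformContinuous _), ?_⟩)
  rw [LinearMap.ker_eq_bot.2 hK.injective]
  infer_instance

theorem pow_mem_approxPointSpectrum_pow {T : X →L[ℂ] X} {μ : ℂ}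
    (hμ : μ ∈ approxPointSpectrum T) (m : ℕ) : μ ^ m ∈ approxPointSpectrum (T ^ m) := by
  obtain ⟨x, hx, hlim⟩ := hμ
  refine ⟨x, hx, ?_⟩
  have hfactor (n : ℕ) : cofactor T μ m (T (x n) - μ • x n) = (T ^ m) (x n) - μ ^ m • x n := by
    rw [← neg_sub, map_neg, ← neg_sub _ ((T ^ m) (x n))]
    exact congrArg Neg.neg (DFunLike.congr_fun (cofactor_mul_algebraMap_sub T μ m) (x n))
  simpa only [Function.comp_def, hfactor, map_zero] using
    ((cofactor T μ m).continuous.tendsto 0).comp hlim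

theorem IsLowerSemiFredholm.eventually [CompleteSpace X] {S : X →L[ℂ] X}
    (hS : IsLowerSemiFredholm S) : ∀ᶠ S' : X →L[ℂ] X in 𝓝 S, IsLowerSemiFredholm S' := by
  obtain ⟨V, hV⟩ := exists_isCompl S.range
  have : FiniteDimensional ℂ (X ⧸ S.range) := hS
  have : FiniteDimensional ℂ V :=
    LinearEquiv.finiteDimensional (Submodule.quotientEquivOfIsCompl _ V hV)
  have hsurj : Function.Surjective (S.coprod V.subtypeL) := by
    refine LinearMap.range_eq_top.1 ((ContinuousLinearMap.range_coprod _ _).trans ?_)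
    simpa using hV.sup_eq_top
  have hcont : Continuous fun S' : X →L[ℂ] X => S'.coprod V.subtypeL :=
    (ContinuousLinearMap.coprodEquivL ℂ).continuous.comp (.prodMk_left V.subtypeL)
  filter_upwards [hcont.continuousAt.eventually (eventually_surjective hsurj)] with S' hS'
  refine Module.Finite.of_surjective (S'.range.mkQ ∘ₗ V.subtype) fun y => ?_
  obtain ⟨y, rfl⟩ := S'.range.mkQ_surjective y
  obtain ⟨⟨x, v⟩, rfl⟩ := hS' y
  exact ⟨v, (Submodule.Quotient.eq _).2 ⟨-x, by simp⟩⟩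

theorem isClosed_lowerSemiFredholmSpectrum [CompleteSpace X] (T : X →L[ℂ] X) :
    IsClosed (lowerSemiFredholmSpectrum T) := by
  have hopen : IsOpen {S : X →L[ℂ] X | IsLowerSemiFredholm S} :=
    isOpen_iff_mem_nhds.2 fun _ hS => IsLowerSemiFredholm.eventually hS
  exact hopen.isClosed_compl.preimage (by fun_prop)

theorem IsUpperSemiFredholm.exists_mapClusterPt [CompleteSpace X] {S : X →L[ℂ] X}
    (hS : IsUpperSemiFredholm S) {f : ℕ → X} {C : ℝ} (hf : ∀ n, ‖f n‖ ≤ C)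
    (hSf : Tendsto (fun n => S (f n)) atTop (𝓝 0)) : ∃ u, MapClusterPt u atTop f := by
  obtain ⟨hclosed, hker⟩ := hS
  have : CompleteSpace S.range := hclosed.completeSpace_coe
  obtain ⟨K, -, hK⟩ :=
    S.rangeRestrict.exists_preimage_norm_le (LinearMap.surjective_rangeRestrict _)
  choose g hg hgK using fun n => hK (S.rangeRestrict (f n))
  change ∀ n, ‖g n‖ ≤ K * ‖S (f n)‖ at hgK
  have hSg (n : ℕ) : S (g n) = S (f n) := congrArg Subtype.val (hg n)
  have hg0 : Tendsto g atTop (𝓝 0) :=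
    squeeze_zero_norm hgK (by simpa only [norm_zero, mul_zero] using hSf.norm.const_mul K)
  let k (n : ℕ) : S.ker := ⟨f n - g n, by simp [hSg]⟩
  obtain ⟨B, hB⟩ := hg0.norm.bddAbove_range
  have hk (n : ℕ) : k n ∈ Metric.closedBall (0 : S.ker) (C + B) := by
    rw [mem_closedBall_zero_iff]
    exact (norm_sub_le _ _).trans (add_le_add (hf n) (hB ⟨n, rfl⟩))
  have : ProperSpace S.ker := FiniteDimensional.proper ℂ _
  obtain ⟨u, -, φ, hφ, hu⟩ := (isCompact_closedBall (0 : S.ker) (C + B)).tendsto_subseq hk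
  have hlim : Tendsto (f ∘ φ) atTop (𝓝 (u : X)) := by
    have hsum := ((continuous_subtype_val.tendsto u).comp hu).add (hg0.comp hφ.tendsto_atTop)
    rw [add_zero] at hsum
    exact hsum.congr fun n => by simp [k]
  exact ⟨u, hlim.mapClusterPt.of_comp hφ.tendsto_atTop⟩

end Spectra

section Topology

variable {X : Type*} [TopologicalSpace X]

theorem eq_of_forall_notMem_finite {Y : Type*} [T1Space X] [∀ x : X, NeBot (𝓝[≠] x)]
    [TopologicalSpace Y] [T2Space Y] {f g : X → Y} (hf : Continuous f)
    (hg : Continuous g) {E : Set X} (hE : E.Finite) (h : ∀ x ∉ E, f x = g x) : f = g := by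
  have hdense : Dense Eᶜ := by simpa [Set.compl_eq_univ_sdiff] using dense_univ.sdiff_finite hE
  exact hf.ext_on hdense hg h

theorem not_continuous_sum_indicator_iterate [T1Space X] [∀ x : X, NeBot (𝓝[≠] x)]
    {φ : X → X} (hφ : Function.Injective φ) {t : X} {m : ℕ} [NeZero m]
    (ht : ∀ i ∈ Finset.Ico 1 m, φ^[i] t ≠ t) {c : ℕ → X → ℂ} (hc : c 0 t ≠ 0) :
    ¬ Continuous fun z => ∑ i ∈ Finset.range m, c i z * ({t} : Set X).indicator 1 (φ^[i] z) := by
  intro hcont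
  have hfinite : (⋃ i ∈ Finset.range m, φ^[i] ⁻¹' {t}).Finite :=
    (Finset.finite_toSet _).biUnion fun i _ =>
      (Set.finite_singleton t).preimage (hφ.iterate i).injOn
  have hzero := eq_of_forall_notMem_finite hcont continuous_const hfinite
    fun z hz => Finset.sum_eq_zero fun i hi => mul_eq_zero_of_right _ <|
      Set.indicator_of_notMem (s := {t}) (fun hiz => hz (Set.mem_biUnion hi hiz)) 1
  refine hc (Eq.trans ?_ (congrFun hzero t))
  rw [Finset.sum_range_eq_add_Ico _ (NeZero.pos m), Finset.sum_eq_zero fun i hi =>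
    mul_eq_zero_of_right _ (Set.indicator_of_notMem (s := {t}) (ht i hi) 1)]
  simp

theorem exists_isOpen_forall_iterate_notMem [T2Space X] {φ : X → X}
    (hφ : Continuous φ) {I : Finset ℕ} {x : X} (hx : ∀ i ∈ I, φ^[i] x ≠ x) :
    ∃ V, IsOpen V ∧ x ∈ V ∧ ∀ y ∈ V, ∀ i ∈ I, φ^[i] y ∉ V := by
  have hne : ∀ᶠ y : X × X in 𝓝 x ×ˢ 𝓝 x, ∀ i ∈ I, φ^[i] y.1 ≠ y.2 := by
    rw [← nhds_prod_eq, eventually_all_finset]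
    exact fun i hi => (isOpen_ne_fun ((hφ.iterate i).comp continuous_fst)
      continuous_snd).mem_nhds (hx i hi)
  obtain ⟨N, hN, hNne⟩ :=
    eventually_prod_self_iff (r := fun y z => ∀ i ∈ I, φ^[i] y ≠ z).1 hne
  exact ⟨interior N, isOpen_interior, mem_interior_iff_mem_nhds.2 hN, fun y hy i hi hiy =>
    hNne y (interior_subset hy) _ (interior_subset hiy) i hi rfl⟩

theorem setOf_pow_eq_subset_closure (m : ℕ) [NeZero m] {g : X → ℂ} (hg : Continuous g)
    {D : Set X} (hD : Dense D) :
    {μ | ∃ t, μ ^ m = g t} ⊆ closure {μ | ∃ s ∈ D, μ ^ m = g s} := by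
  rintro μ ⟨t, ht⟩
  have himage : {μ | ∃ s ∈ D, μ ^ m = g s} = (· ^ m) ⁻¹' (g '' D) := by
    ext ν
    simp only [Set.mem_ofPred_eq, Set.mem_preimage, Set.mem_image, eq_comm]
  rw [himage]
  exact (Complex.isOpenQuotientMap_pow m).isOpenMap.preimage_closure_subset_closure_preimage
    (hg.range_subset_closure_image_dense hD ⟨t, ht.symm⟩)

end Topology

section ComplexAnalysis

variable {E F : Type*} [NormedAddCommGroup E] [NormedSpace ℂ E]
  [NormedAddCommGroup F] [NormedSpace ℂ F]

theorem uniformCauchySeqOn_fderiv_ball {f : ℕ → E → F} {x : E} {r : ℝ} (hr : 0 < r)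
    (hf : ∀ n, DifferentiableOn ℂ (f n) (Metric.ball x r))
    (hcauchy : UniformCauchySeqOn f atTop (Metric.ball x r)) :
    UniformCauchySeqOn (fun n => fderiv ℂ (f n)) atTop (Metric.ball x (r / 2)) := by
  rw [Metric.uniformCauchySeqOn_iff] at hcauchy ⊢
  intro ε hε
  obtain ⟨N, hN⟩ := hcauchy (ε * r / 8) (by positivity)
  refine ⟨N, fun m hm n hn y hy => ?_⟩
  have hball : Metric.ball y (r / 2) ⊆ Metric.ball x r :=
    Metric.ball_subset_ball' (by rw [Metric.mem_ball] at hy; linarith)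
  have hyr : y ∈ Metric.ball x r := hball (Metric.mem_ball_self (by positivity))
  have hdiff (k : ℕ) : DifferentiableAt ℂ (f k) y :=
    (hf k).differentiableAt (Metric.isOpen_ball.mem_nhds hyr)
  have hmaps : Set.MapsTo (f m - f n) (Metric.ball y (r / 2))
      (Metric.closedBall ((f m - f n) y) (ε * r / 4)) := by
    intro z hz
    have hmnz := hN m hm n hn z (hball hz)
    have hmny := hN m hm n hn y hyr
    rw [dist_eq_norm] at hmnz hmny
    rw [Metric.mem_closedBall, dist_eq_norm]
    refine (norm_sub_le _ _).trans ?_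
    simp only [Pi.sub_apply]
    linarith
  rw [dist_eq_norm, ← fderiv_sub (hdiff m) (hdiff n)]
  refine (Complex.norm_fderiv_le_div_of_mapsTo_ball (((hf m).sub (hf n)).mono hball) hmaps
    (by positivity)).trans_lt ?_
  rw [div_lt_iff₀ (by positivity)]
  linarith [mul_pos hε hr]

theorem differentiableOn_of_tendstoUniformlyOn [CompleteSpace F] {U : Set E} (hU : IsOpen U)
    {f : ℕ → E → F} {g : E → F} (hf : ∀ n, DifferentiableOn ℂ (f n) U)
    (hfg : TendstoUniformlyOn f g atTop U) : DifferentiableOn ℂ g U := by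
  intro x hx
  obtain ⟨r, hr, hrU⟩ := Metric.isOpen_iff.1 hU x hx
  have hhalf : Metric.ball x (r / 2) ⊆ U :=
    (Metric.ball_subset_ball (half_le_self hr.le)).trans hrU
  have hcauchy := uniformCauchySeqOn_fderiv_ball hr (fun n => (hf n).mono hrU)
    (hfg.mono hrU).uniformCauchySeqOn
  have hlim (y : E) (hy : y ∈ Metric.ball x (r / 2)) :
      ∃ L, Tendsto (fun n => fderiv ℂ (f n) y) atTop (𝓝 L) :=
    cauchySeq_tendsto_of_complete (hcauchy.cauchySeq hy)
  choose! g' hg' using hlim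
  have hderiv : HasFDerivAt g (g' x) x :=
    hasFDerivAt_of_tendstoUniformlyOn Metric.isOpen_ball
      (hcauchy.tendstoUniformlyOn_of_tendsto hg')
      (fun n y hy => ((hf n).differentiableAt (hU.mem_nhds (hhalf hy))).hasFDerivAt)
      (fun y hy => hfg.tendsto_at (hhalf hy)) (Metric.mem_ball_self (by positivity))
  exact hderiv.differentiableAt.differentiableWithinAt

theorem norm_le_of_forall_norm_eq_one_norm_le {g : ℂ → F} {C : ℝ}
    (hg : ∀ u, ‖u‖ ≤ 1 → DifferentiableAt ℂ g u) (hC : ∀ u, ‖u‖ = 1 → ‖g u‖ ≤ C)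
    {u : ℂ} (hu : ‖u‖ ≤ 1) : ‖g u‖ ≤ C := by
  have hclosure : closure (Metric.ball (0 : ℂ) 1) = Metric.closedBall 0 1 :=
    closure_ball _ one_ne_zero
  refine Complex.norm_le_of_forall_mem_frontier_norm_le (U := Metric.ball 0 1)
    Metric.isBounded_ball (DifferentiableOn.diffContOnCl fun v hv => ?_) (fun v hv => hC v ?_) ?_
  · rw [hclosure, mem_closedBall_zero_iff] at hv
    exact (hg v hv).differentiableWithinAt
  · rwa [frontier_ball _ one_ne_zero, mem_sphere_zero_iff_norm] at hv
  · rwa [hclosure, mem_closedBall_zero_iff]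

theorem exists_mem_ball_eq_zero {f : ℂ → ℂ} {b : ℂ} {ρ δ : ℝ} (hρ : 0 < ρ)
    (hf : DiffContOnCl ℂ f (Metric.ball b ρ)) (hb : ‖f b‖ < δ)
    (hδ : ∀ z ∈ Metric.sphere b ρ, δ ≤ ‖f z‖) : ∃ z ∈ Metric.ball b ρ, f z = 0 := by
  by_contra! hball
  have hδ0 : 0 < δ := (norm_nonneg _).trans_lt hb
  have hne : ∀ z ∈ closure (Metric.ball b ρ), f z ≠ 0 := fun z hz => by
    rw [closure_ball b hρ.ne', ← Metric.ball_union_sphere] at hz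
    exact hz.elim (hball z) fun hz => norm_pos_iff.1 (hδ0.trans_le (hδ z hz))
  have hinv : ‖(f b)⁻¹‖ ≤ δ⁻¹ :=
    Complex.norm_le_of_forall_mem_frontier_norm_le Metric.isBounded_ball (hf.inv hne)
      (fun z hz => by
        rw [frontier_ball b hρ.ne'] at hz
        rw [Pi.inv_apply, norm_inv]
        exact inv_anti₀ hδ0 (hδ z hz))
      (subset_closure (Metric.mem_ball_self hρ))
  rw [norm_inv, inv_le_inv₀ (norm_pos_iff.2 (hball b (Metric.mem_ball_self hρ))) hδ0] at hinv
  exact hinv.not_gt hb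

theorem eventually_exists_mem_ball_eq_zero {X : Type*} [TopologicalSpace X] {f : X × ℂ → ℂ}
    {a : X} {b : ℂ} {ρ : ℝ} (hρ : 0 < ρ)
    (hcont : ∀ z ∈ Metric.closedBall b ρ, ContinuousAt f (a, z))
    (hdiff : ∀ᶠ x in 𝓝 a, DiffContOnCl ℂ (fun z => f (x, z)) (Metric.ball b ρ))
    (hb : f (a, b) = 0) (hsphere : ∀ z ∈ Metric.sphere b ρ, f (a, z) ≠ 0) :
    ∀ᶠ x in 𝓝 a, ∃ z ∈ Metric.ball b ρ, f (x, z) = 0 := by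
  have hslice (z) (hz : z ∈ Metric.sphere b ρ) : ContinuousAt f (a, z) :=
    hcont z (Metric.sphere_subset_closedBall hz)
  obtain ⟨δ, hδ, hδf⟩ := (isCompact_sphere b ρ).exists_forall_le'
    (f := fun z => ‖f (a, z)‖) (fun z hz => ((hslice z hz).comp
      (f := Prod.mk a) (by fun_prop)).norm.continuousWithinAt)
    fun z hz => norm_pos_iff.2 (hsphere z hz)
  have hnear : ∀ᶠ x in 𝓝 a, ∀ z ∈ Metric.sphere b ρ, δ / 2 < ‖f (x, z)‖ :=
    (isCompact_sphere b ρ).eventually_forall_of_forall_eventually fun z hz =>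
      (hslice z hz).norm.eventually (lt_mem_nhds ((half_lt_self hδ).trans_le (hδf z hz)))
  have hcentre : ∀ᶠ x in 𝓝 a, ‖f (x, b)‖ < δ / 2 := by
    have hcb : ContinuousAt (fun x => f (x, b)) a :=
      (hcont b (Metric.mem_closedBall_self hρ.le)).comp (f := fun x => (x, b)) (by fun_prop)
    exact hcb.norm.eventually (gt_mem_nhds (by simpa [hb] using hδ))
  filter_upwards [hnear, hcentre, hdiff] with x hx hxb hxd
  exact exists_mem_ball_eq_zero hρ hxd hxb fun z hz => (hx z hz).le

theorem infinite_zeros_of_differentiableOn {U : Set (ℂ × ℂ)} (hU : IsOpen U) {f : ℂ × ℂ → ℂ}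
    (hf : DifferentiableOn ℂ f U) {t : ℂ × ℂ} (ht : t ∈ U) (h0 : f t = 0) :
    {s ∈ U | f s = 0}.Infinite := by
  intro hfin
  obtain ⟨a, b⟩ := t
  obtain ⟨r, hr, hrU⟩ := Metric.isOpen_iff.1 hU _ ht
  rw [← ball_prod_same] at hrU
  obtain ⟨ρ, ⟨hρ, hρr⟩, hρzero⟩ :=
    ((Set.Ioo_infinite hr).sdiff (hfin.image fun s => dist s.2 b)).nonempty
  have hmem {x z : ℂ} (hx : x ∈ Metric.ball a r) (hz : z ∈ Metric.closedBall b ρ) : (x, z) ∈ U :=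
    hrU ⟨hx, Metric.closedBall_subset_ball hρr hz⟩
  have hzeros : ∀ᶠ x in 𝓝 a, ∃ z ∈ Metric.ball b ρ, f (x, z) = 0 := by
    refine eventually_exists_mem_ball_eq_zero hρ (fun z hz => ?_) ?_ h0 fun z hz hz0 => ?_
    · exact hf.continuousOn.continuousAt (hU.mem_nhds (hmem (Metric.mem_ball_self hr) hz))
    · filter_upwards [Metric.ball_mem_nhds a hr] with x hx
      exact (hf.comp (f := Prod.mk x) (by fun_prop) fun z => hmem hx).diffContOnCl_ball subset_rfl
    · exact hρzero ⟨(a, z),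
        ⟨hmem (Metric.mem_ball_self hr) (Metric.sphere_subset_closedBall hz), hz0⟩, hz⟩
  have hproj : Prod.fst '' {s ∈ U | f s = 0} ∈ 𝓝 a := by
    filter_upwards [hzeros, Metric.ball_mem_nhds a hr] with x ⟨z, hz, hz0⟩ hx
    exact ⟨(x, z), ⟨hmem hx (Metric.ball_subset_closedBall hz), hz0⟩, rfl⟩
  exact infinite_of_mem_nhds a hproj (hfin.image _)

end ComplexAnalysis

section PeakFunctions

variable {K : Type*}

/-- A function peaks at `t` if it takes the value `1` at `t` and values of modulus less than `1`
at all other points, so that its powers converge pointwise to the indicator function of `{t}`. -/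
structure IsPeakFunction (g : K → ℂ) (t : K) : Prop where
  eq_one : g t = 1
  norm_lt_one : ∀ s, s ≠ t → ‖g s‖ < 1

variable {g : K → ℂ} {t : K}

theorem IsPeakFunction.norm_le_one (hg : IsPeakFunction g t) (s : K) : ‖g s‖ ≤ 1 := by
  obtain rfl | hs := eq_or_ne s t
  · rw [hg.eq_one, norm_one]
  · exact (hg.norm_lt_one s hs).le

theorem IsPeakFunction.tendsto_pow (hg : IsPeakFunction g t) (s : K) :
    Tendsto (fun n : ℕ => g s ^ n) atTop (𝓝 (({t} : Set K).indicator 1 s)) := by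
  obtain rfl | hs := eq_or_ne s t
  · simp [hg.eq_one]
  · simpa [hs] using tendsto_pow_atTop_nhds_zero_of_norm_lt_one (hg.norm_lt_one s hs)

theorem IsPeakFunction.comp {L : Type*} {φ : L → K} (hφ : Function.Injective φ) {s : L}
    (hg : IsPeakFunction g (φ s)) : IsPeakFunction (g ∘ φ) s :=
  ⟨hg.eq_one, fun r hr => hg.norm_lt_one (φ r) (hφ.ne hr)⟩

theorem IsPeakFunction.tendsto_mul_pow [TopologicalSpace K] [CompactSpace K] {h g : C(K, ℂ)}
    (hg : IsPeakFunction g t) (ht : h t = 0) : Tendsto (fun n => h * g ^ n) atTop (𝓝 0) := by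
  have hDini : TendstoUniformly (fun n s => ‖h s‖ * ‖g s‖ ^ n) (fun _ => (0 : ℝ)) atTop := by
    refine Antitone.tendstoUniformly_of_forall_tendsto (fun n => by fun_prop) (fun n k hnk s => ?_)
      continuous_const fun s => ?_
    · exact mul_le_mul_of_nonneg_left
        (pow_le_pow_of_le_one (norm_nonneg _) (hg.norm_le_one s) hnk) (norm_nonneg _)
    · obtain rfl | hs := eq_or_ne s t
      · simp [ht]
      · simpa using (tendsto_pow_atTop_nhds_zero_of_lt_one (norm_nonneg _)
          (hg.norm_lt_one s hs)).const_mul ‖h s‖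
  rw [ContinuousMap.tendsto_iff_tendstoUniformly, Metric.tendstoUniformly_iff]
  rw [Metric.tendstoUniformly_iff] at hDini
  intro ε hε
  filter_upwards [hDini ε hε] with n hn s
  simpa using hn s

theorem norm_one_add_div_two_le_one {u : ℂ} (hu : ‖u‖ ≤ 1) : ‖(1 + u) / 2‖ ≤ 1 := by
  rw [norm_div, Complex.norm_two, div_le_one two_pos]
  exact (norm_add_le 1 u).trans (by rw [norm_one]; linarith)

theorem norm_one_add_div_two_lt_one {u : ℂ} (hu : ‖u‖ ≤ 1) (hu1 : u ≠ 1) :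
    ‖(1 + u) / 2‖ < 1 := by
  have hcombo := norm_combo_lt_of_ne (a := 1 / 2) (b := 1 / 2) norm_one.le hu hu1.symm
    (by norm_num) (by norm_num) (by norm_num)
  rwa [← smul_add, Complex.real_smul, Complex.ofReal_div, Complex.ofReal_one, Complex.ofReal_ofNat,
    one_div_mul_eq_div] at hcombo

end PeakFunctions

section ClosedBidisc

theorem closedBidisc_eq_prod :
    closedBidisc = Metric.closedBall (0 : ℂ) 1 ×ˢ Metric.closedBall (0 : ℂ) 1 := by
  ext z
  simp [closedBidisc]

instance instConnectedSpaceClosedBidisc : ConnectedSpace closedBidisc := by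
  refine isConnected_iff_connectedSpace.1 (Convex.isConnected ?_ ⟨0, by simp [closedBidisc]⟩)
  rw [closedBidisc_eq_prod]
  exact (convex_closedBall _ _).prod (convex_closedBall _ _)

instance instNontrivialClosedBidisc : Nontrivial closedBidisc :=
  ⟨⟨(0, 0), by simp [closedBidisc]⟩, ⟨(1, 1), by simp [closedBidisc]⟩,
    fun h => zero_ne_one (congrArg (fun z : closedBidisc => z.1.1) h)⟩

theorem isOpen_openBidisc : IsOpen openBidisc :=
  (isOpen_lt continuous_fst.norm continuous_const).inter
    (isOpen_lt continuous_snd.norm continuous_const)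

theorem openBidisc_subset_closedBidisc : openBidisc ⊆ closedBidisc :=
  fun _ hz => ⟨hz.1.le, hz.2.le⟩

theorem isCompact_torus : IsCompact torus := by
  refine IsClosed.isCompact ((isClosed_eq ?_ continuous_const).inter
    (isClosed_eq ?_ continuous_const)) <;> fun_prop

theorem torus_nonempty : torus.Nonempty :=
  ⟨⟨(1, 1), by simp [closedBidisc]⟩, by simp [torus]⟩

theorem fst_ne_zero_of_mem_torus {t : closedBidisc} (ht : t ∈ torus) : t.1.1 ≠ 0 :=
  norm_ne_zero_iff.1 (ht.1.trans_ne one_ne_zero)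

theorem snd_ne_zero_of_mem_torus {t : closedBidisc} (ht : t ∈ torus) : t.1.2 ≠ 0 :=
  norm_ne_zero_iff.1 (ht.2.trans_ne one_ne_zero)

/-- The points of the open bidisc off the coordinate axes; here the rotation `Φ` acts freely. -/
def puncturedBidisc : Set closedBidisc := {z | z.1 ∈ openBidisc ∧ z.1.1 ≠ 0 ∧ z.1.2 ≠ 0}

theorem dense_puncturedBidisc : Dense puncturedBidisc := by
  intro z
  have hdisc : Metric.closedBall (0 : ℂ) 1 ⊆ closure (Metric.ball 0 1 ∩ {0}ᶜ) := by
    rw [← closure_ball (0 : ℂ) one_ne_zero]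
    exact closure_minimal ((dense_compl_singleton 0).open_subset_closure_inter Metric.isOpen_ball)
      isClosed_closure
  have hz : z.1 ∈ closure ((Metric.ball (0 : ℂ) 1 ∩ {0}ᶜ) ×ˢ (Metric.ball (0 : ℂ) 1 ∩ {0}ᶜ)) := by
    rw [closure_prod_eq]
    exact Set.prod_mono hdisc hdisc (closedBidisc_eq_prod ▸ z.2)
  rw [closure_subtype]
  refine closure_mono ?_ hz
  rintro ⟨a, b⟩ ⟨⟨ha, ha0⟩, hb, hb0⟩
  rw [mem_ball_zero_iff] at ha hb
  exact ⟨⟨(a, b), ha.le, hb.le⟩, ⟨⟨ha, hb⟩, ha0, hb0⟩, rfl⟩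

end ClosedBidisc

section BidiscAlgebra

/-- Extension by zero of a function on the closed bidisc. -/
def zeroExtend (f : closedBidisc → ℂ) : ℂ × ℂ → ℂ := Function.extend Subtype.val f 0

@[simp]
theorem zeroExtend_coe (f : closedBidisc → ℂ) (z : closedBidisc) : zeroExtend f z = f z :=
  Subtype.val_injective.extend_apply _ _ _

theorem mem_bidiscAlgebra_iff {f : C(closedBidisc, ℂ)} :
    f ∈ bidiscAlgebra ↔ DifferentiableOn ℂ (zeroExtend f) openBidisc := by
  refine ⟨fun ⟨F, hF, hFf⟩ => hF.congr fun z hz => ?_, fun h => ⟨_, h, zeroExtend_coe f⟩⟩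
  lift z to closedBidisc using openBidisc_subset_closedBidisc hz
  rw [zeroExtend_coe, hFf]

theorem isClosed_bidiscAlgebra : IsClosed (bidiscAlgebra : Set C(closedBidisc, ℂ)) := by
  refine IsSeqClosed.isClosed fun F f hF hf => ?_
  rw [SetLike.mem_coe, mem_bidiscAlgebra_iff]
  refine differentiableOn_of_tendstoUniformlyOn isOpen_openBidisc
    (fun n => mem_bidiscAlgebra_iff.1 (hF n)) ?_
  rw [ContinuousMap.tendsto_iff_tendstoUniformly, Metric.tendstoUniformly_iff] at hf
  rw [Metric.tendstoUniformlyOn_iff]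
  intro ε hε
  filter_upwards [hf ε hε] with n hn z hz
  lift z to closedBidisc using openBidisc_subset_closedBidisc hz
  simpa only [zeroExtend_coe] using hn z

instance instCompleteSpaceBidiscAlgebra : CompleteSpace bidiscAlgebra :=
  isClosed_bidiscAlgebra.completeSpace_coe

theorem isUnit_of_forall_ne_zero {f : bidiscAlgebra} (hf : ∀ z, f.1 z ≠ 0) : IsUnit f := by
  have hinv : (⟨fun z => (f.1 z)⁻¹, f.1.continuous.inv₀ hf⟩ : C(closedBidisc, ℂ)) ∈
      bidiscAlgebra := by
    refine ⟨fun z => (zeroExtend f.1 z)⁻¹, (mem_bidiscAlgebra_iff.1 f.2).inv fun z hz => ?_,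
      fun z => by simp⟩
    lift z to closedBidisc using openBidisc_subset_closedBidisc hz
    simpa using hf z
  exact IsUnit.of_mul_eq_one ⟨_, hinv⟩
    (Subtype.ext (ContinuousMap.ext fun z => mul_inv_cancel₀ (hf z)))

theorem infinite_zeros {f : bidiscAlgebra} {V : Set closedBidisc} (hV : IsOpen V)
    {t : closedBidisc} (htV : t ∈ V) (ht : t.1 ∈ openBidisc) (h0 : f.1 t = 0) :
    {s ∈ V | f.1 s = 0}.Infinite := by
  obtain ⟨U, hU, rfl⟩ := isOpen_induced_iff.1 hV
  have hinf := infinite_zeros_of_differentiableOn (hU.inter isOpen_openBidisc)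
    ((mem_bidiscAlgebra_iff.1 f.2).mono Set.inter_subset_right) (t := t) ⟨htV, ht⟩ (by simpa)
  refine Set.Infinite.of_image Subtype.val (hinf.mono ?_)
  rintro s ⟨⟨hsU, hso⟩, hs0⟩
  lift s to closedBidisc using openBidisc_subset_closedBidisc hso
  exact ⟨s, ⟨hsU, by simpa using hs0⟩, rfl⟩

/-- The restriction of a linear functional on `ℂ²`, as an element of the bidisc algebra. -/
def linearFunction (L : ℂ × ℂ →L[ℂ] ℂ) : bidiscAlgebra :=
  ⟨⟨fun z => L z, by fun_prop⟩, L, L.differentiable.differentiableOn, fun _ => rfl⟩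

/-- Evaluation at a point of the closed bidisc, as a character of the bidisc algebra. -/
def evalHom (z : closedBidisc) : bidiscAlgebra →ₐ[ℂ] ℂ :=
  (ContinuousMap.evalAlgHom ℂ ℂ z).comp bidiscAlgebra.val

theorem evalHom_injective : Function.Injective evalHom := fun _ _ hzs =>
  Subtype.ext (Prod.ext (DFunLike.congr_fun hzs (linearFunction (.fst ℂ ℂ ℂ)))
    (DFunLike.congr_fun hzs (linearFunction (.snd ℂ ℂ ℂ))))

theorem continuous_evalHom (z : closedBidisc) : Continuous (evalHom z) :=
  (continuous_eval_const z).comp continuous_subtype_val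

theorem linearIndependent_evalHom : LinearIndependent ℂ fun z => (evalHom z).toLinearMap :=
  (linearIndependent_toLinearMap ℂ bidiscAlgebra ℂ).comp evalHom evalHom_injective

theorem exists_isPeakFunction {t : closedBidisc} (ht : t ∈ torus) :
    ∃ g : bidiscAlgebra, IsPeakFunction g.1 t := by
  have ha := fst_ne_zero_of_mem_torus ht
  have hb := snd_ne_zero_of_mem_torus ht
  let g (c : ℂ) (L : ℂ × ℂ →L[ℂ] ℂ) : bidiscAlgebra :=
    (2⁻¹ : ℂ) • (1 + linearFunction (c⁻¹ • L))
  have hg (z : closedBidisc) : (g t.1.1 (.fst ℂ ℂ ℂ) * g t.1.2 (.snd ℂ ℂ ℂ)).1 z =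
      (1 + t.1.1⁻¹ * z.1.1) / 2 * ((1 + t.1.2⁻¹ * z.1.2) / 2) := by
    simp only [div_eq_inv_mul]
    rfl
  refine ⟨g t.1.1 (.fst ℂ ℂ ℂ) * g t.1.2 (.snd ℂ ℂ ℂ), ?_, fun s hs => ?_⟩
  · rw [hg, inv_mul_cancel₀ ha, inv_mul_cancel₀ hb]
    norm_num
  · have hs₁ : ‖t.1.1⁻¹ * s.1.1‖ ≤ 1 := by simpa [ht.1] using s.2.1
    have hs₂ : ‖t.1.2⁻¹ * s.1.2‖ ≤ 1 := by simpa [ht.2] using s.2.2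
    rw [hg, norm_mul]
    by_cases hst : t.1.1 = s.1.1
    · have hne : t.1.2⁻¹ * s.1.2 ≠ 1 := fun h =>
        hs (Subtype.ext (Prod.ext hst.symm ((inv_mul_eq_one₀ hb).1 h).symm))
      exact mul_lt_one_of_nonneg_of_lt_one_right (norm_one_add_div_two_le_one hs₁) (norm_nonneg _)
        (norm_one_add_div_two_lt_one hs₂ hne)
    · have hne : t.1.1⁻¹ * s.1.1 ≠ 1 := fun h => hst ((inv_mul_eq_one₀ ha).1 h)
      exact mul_lt_one_of_nonneg_of_lt_one_left (norm_nonneg _)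
        (norm_one_add_div_two_lt_one hs₁ hne) (norm_one_add_div_two_le_one hs₂)

end BidiscAlgebra

section TorusBoundary

theorem norm_le_of_forall_torus_of_differentiableAt {F : Type*} [NormedAddCommGroup F]
    [NormedSpace ℂ F] {G : ℂ × ℂ → F} {C : ℝ} (hG : ∀ z ∈ closedBidisc, DifferentiableAt ℂ G z)
    (hC : ∀ t ∈ torus, ‖G t‖ ≤ C) {z : ℂ × ℂ} (hz : z ∈ closedBidisc) : ‖G z‖ ≤ C := by
  refine norm_le_of_forall_norm_eq_one_norm_le (g := fun a => G (a, z.2))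
    (fun a ha => (hG (a, z.2) ⟨ha, hz.2⟩).comp a (f := fun a => (a, z.2)) (by fun_prop))
    (fun a ha => ?_) hz.1
  exact norm_le_of_forall_norm_eq_one_norm_le (g := fun b => G (a, b))
    (fun b hb => (hG (a, b) ⟨ha.le, hb⟩).comp b (f := fun b => (a, b)) (by fun_prop))
    (fun b hb => hC ⟨(a, b), ha.le, hb.le⟩ ⟨ha, hb⟩) hz.2

/-- The dilation `(r, z) ↦ r z`, which maps the closed bidisc into the open one for `r < 1`. -/
def dilation : C(unitInterval × closedBidisc, closedBidisc) where
  toFun x := ⟨(x.1 : ℝ) • x.2.1, by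
    constructor <;> rw [← mul_one (1 : ℝ)] <;>
      simp only [Prod.smul_fst, Prod.smul_snd, norm_smul, Real.norm_of_nonneg x.1.2.1]
    exacts [mul_le_mul x.1.2.2 x.2.2.1 (norm_nonneg _) one_pos.le,
      mul_le_mul x.1.2.2 x.2.2.2 (norm_nonneg _) one_pos.le]⟩
  continuous_toFun := by fun_prop

theorem dilation_mem_openBidisc {r : unitInterval} (hr : r < 1) (z : closedBidisc) :
    (dilation (r, z)).1 ∈ openBidisc := by
  have hcoord {u : ℂ} (hu : ‖u‖ ≤ 1) : ‖(r : ℝ) • u‖ < 1 := by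
    rw [norm_smul, Real.norm_of_nonneg r.2.1]
    exact (mul_le_of_le_one_right r.2.1 hu).trans_lt hr
  exact ⟨hcoord z.2.1, hcoord z.2.2⟩

theorem norm_dilation_le_of_forall_torus {f : bidiscAlgebra} {r : unitInterval} (hr : r < 1)
    {C : ℝ} (hC : ∀ t ∈ torus, ‖f.1 (dilation (r, t))‖ ≤ C) (z : closedBidisc) :
    ‖f.1 (dilation (r, z))‖ ≤ C := by
  let G (s : ℂ × ℂ) : ℂ := zeroExtend f.1 ((r : ℝ) • s)
  have hG (s : closedBidisc) : G s = f.1 (dilation (r, s)) := zeroExtend_coe f.1 (dilation (r, s))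
  rw [← hG]
  refine norm_le_of_forall_torus_of_differentiableAt (fun s hs => ?_)
    (fun t ht => (hG t).symm ▸ hC t ht) z.2
  have hf : DifferentiableAt ℂ (zeroExtend f.1) ((r : ℝ) • s) :=
    (mem_bidiscAlgebra_iff.1 f.2).differentiableAt
      (isOpen_openBidisc.mem_nhds (dilation_mem_openBidisc hr ⟨s, hs⟩))
  exact hf.comp s (f := fun s => (r : ℝ) • s) (by fun_prop)

theorem norm_le_of_forall_torus {f : bidiscAlgebra} {C : ℝ} (hC : ∀ t ∈ torus, ‖f.1 t‖ ≤ C) :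
    ‖f‖ ≤ C := by
  obtain ⟨t₀, ht₀⟩ := torus_nonempty
  refine (ContinuousMap.norm_le _ ((norm_nonneg _).trans (hC t₀ ht₀))).2 fun z =>
    le_of_forall_gt_imp_ge_of_dense fun B hB => ?_
  have hdilation_one (s : closedBidisc) : dilation (1, s) = s := Subtype.ext (one_smul ℝ s.1)
  have hcont : Continuous fun x => ‖f.1 (dilation x)‖ := by fun_prop
  have htorus : ∀ᶠ r in 𝓝[<] (1 : unitInterval), ∀ t ∈ torus, ‖f.1 (dilation (r, t))‖ < B :=
    nhdsWithin_le_nhds <| isCompact_torus.eventually_forall_of_forall_eventually fun t ht =>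
      hcont.continuousAt.eventually
        (gt_mem_nhds (by simpa only [hdilation_one] using (hC t ht).trans_lt hB))
  have hlim : Tendsto (fun r => ‖f.1 (dilation (r, z))‖) (𝓝[<] 1) (𝓝 ‖f.1 z‖) := by
    have hz : Continuous fun r => ‖f.1 (dilation (r, z))‖ := by fun_prop
    simpa only [hdilation_one] using (hz.tendsto 1).mono_left nhdsWithin_le_nhds
  have : NeBot (𝓝[<] (1 : unitInterval)) := nhdsLT_neBot_of_exists_lt ⟨0, zero_lt_one⟩
  refine le_of_tendsto hlim ?_
  filter_upwards [htorus, self_mem_nhdsWithin] with r hr hr1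
  exact norm_dilation_le_of_forall_torus hr1 (fun t ht => (hr t ht).le) z

end TorusBoundary

section MultiplicationOperators

theorem algebraMap_sub_mul_eq {𝕜 A : Type*} [NontriviallyNormedField 𝕜] [NormedRing A]
    [NormedAlgebra 𝕜 A] (μ : 𝕜) (h : A) :
    algebraMap 𝕜 (A →L[𝕜] A) μ - ContinuousLinearMap.mul 𝕜 A h =
      ContinuousLinearMap.mul 𝕜 A (algebraMap 𝕜 A μ - h) := by
  ext f
  rw [ContinuousLinearMap.mul_apply', sub_mul, ← Algebra.smul_def]
  rfl

theorem spectrum_mul_subset (h : bidiscAlgebra) :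
    spectrum ℂ (ContinuousLinearMap.mul ℂ bidiscAlgebra h) ⊆ Set.range h.1 := by
  intro μ hμ
  by_contra hrange
  have hunit : IsUnit (algebraMap ℂ bidiscAlgebra μ - h) :=
    isUnit_of_forall_ne_zero fun z hz => hrange ⟨z, (sub_eq_zero.1 hz).symm⟩
  refine hμ (ContinuousLinearMap.isUnit_iff_bijective.2 ?_)
  rw [algebraMap_sub_mul_eq]
  exact IsUnit.isUnit_iff_mulLeft_bijective.1 hunit

theorem approxPointSpectrum_mul_subset (h : bidiscAlgebra) :
    approxPointSpectrum (ContinuousLinearMap.mul ℂ bidiscAlgebra h) ⊆ h.1 '' torus := by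
  intro μ hμ
  by_contra himage
  obtain ⟨δ, hδ, hbound⟩ := isCompact_torus.exists_forall_le' (f := fun t => ‖μ - h.1 t‖)
    (by fun_prop) fun t ht => norm_pos_iff.2 (sub_ne_zero.2 fun heq => himage ⟨t, ht, heq.symm⟩)
  refine notMem_approxPointSpectrum_iff.2 ⟨.mk δ⁻¹ (inv_pos.2 hδ).le, ?_⟩ hμ
  refine ContinuousLinearMap.antilipschitz_of_bound _ fun f =>
    norm_le_of_forall_torus fun t ht => ?_
  rw [NNReal.coe_mk, le_inv_mul_iff₀ hδ]
  calc δ * ‖f.1 t‖ ≤ ‖μ - h.1 t‖ * ‖f.1 t‖ := by gcongr; exact hbound t ht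
    _ = ‖(μ • f - h * f).1 t‖ := by rw [← norm_mul, sub_mul]; rfl
    _ ≤ ‖μ • f - h * f‖ := ContinuousMap.norm_coe_le_norm (μ • f - h * f).1 t

end MultiplicationOperators

section UpperSemiFredholm

theorem IsUpperSemiFredholm.continuous_of_tendsto {S : bidiscAlgebra →L[ℂ] bidiscAlgebra}
    (hS : IsUpperSemiFredholm S) {f : ℕ → bidiscAlgebra} {C : ℝ} (hf : ∀ n, ‖f n‖ ≤ C)
    (hSf : Tendsto (fun n => S (f n)) atTop (𝓝 0)) {φ : closedBidisc → ℂ}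
    (hφ : ∀ z, Tendsto (fun n => (f n).1 z) atTop (𝓝 (φ z))) : Continuous φ := by
  obtain ⟨u, hu⟩ := hS.exists_mapClusterPt hf hSf
  have huφ : φ = u.1 := funext fun z => by
    have hcluster : MapClusterPt (u.1 z) atTop fun n => (f n).1 z :=
      hu.continuousAt_comp (continuous_evalHom z).continuousAt
    exact (eq_of_nhds_neBot (ClusterPt.mono hcluster (hφ z))).symm
  exact huφ ▸ u.1.continuous

end UpperSemiFredholm

section Rotation

theorem isPrimitiveRoot_prodMk {M N : Type*} [CommMonoid M] [CommMonoid N] {a : M} {b : N}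
    {p q : ℕ} (ha : IsPrimitiveRoot a p) (hb : IsPrimitiveRoot b q) :
    IsPrimitiveRoot (a, b) (p.lcm q) := by
  rw [IsPrimitiveRoot.iff_orderOf, Prod.orderOf_mk, ← ha.eq_orderOf, ← hb.eq_orderOf]

variable {α₁ α₂ : Circle}

theorem rotation_injective : Function.Injective (rotation α₁ α₂) := fun _ _ h =>
  Subtype.ext (Prod.ext
    (mul_left_cancel₀ α₁.coe_ne_zero (congrArg (fun z : closedBidisc => z.1.1) h))
    (mul_left_cancel₀ α₂.coe_ne_zero (congrArg (fun z : closedBidisc => z.1.2) h)))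

theorem rotation_iterate_coe (k : ℕ) (z : closedBidisc) :
    ((rotation α₁ α₂)^[k] z : ℂ × ℂ) = ((α₁ : ℂ) ^ k * z.1.1, (α₂ : ℂ) ^ k * z.1.2) := by
  induction k with
  | zero => simp
  | succ k ih =>
    rw [Function.iterate_succ_apply', pow_succ', pow_succ', mul_assoc, mul_assoc]
    exact congrArg (fun u : ℂ × ℂ => ((α₁ : ℂ) * u.1, (α₂ : ℂ) * u.2)) ih

theorem rotation_iterate_mem_torus {t : closedBidisc} (ht : t ∈ torus) (k : ℕ) :
    (rotation α₁ α₂)^[k] t ∈ torus := by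
  simpa [torus, rotation_iterate_coe, Circle.norm_coe] using ht

theorem rotation_iterate_mem_openBidisc {t : closedBidisc} (ht : t.1 ∈ openBidisc) (k : ℕ) :
    ((rotation α₁ α₂)^[k] t).1 ∈ openBidisc := by
  simpa [openBidisc, rotation_iterate_coe, Circle.norm_coe] using ht

theorem rotation_iterate_eq_id {m : ℕ} (hα : (α₁, α₂) ^ m = 1) :
    (rotation α₁ α₂)^[m] = id := by
  have h₁ : α₁ ^ m = 1 := congrArg Prod.fst hα
  have h₂ : α₂ ^ m = 1 := congrArg Prod.snd hα
  refine funext fun z => Subtype.ext ?_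
  rw [rotation_iterate_coe, ← Circle.coe_pow, ← Circle.coe_pow, h₁, h₂, Circle.coe_one, one_mul,
    one_mul, id_eq]

theorem rotation_iterate_ne {m : ℕ} (hα : IsPrimitiveRoot (α₁, α₂) m) {z : closedBidisc}
    (hz₁ : z.1.1 ≠ 0) (hz₂ : z.1.2 ≠ 0) {k : ℕ} (hk : k ∈ Finset.Ico 1 m) :
    (rotation α₁ α₂)^[k] z ≠ z := by
  rw [Finset.mem_Ico] at hk
  intro hfix
  have hfix' := congrArg Subtype.val hfix
  rw [rotation_iterate_coe, Prod.ext_iff] at hfix'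
  refine hα.pow_ne_one_of_pos_of_lt (Nat.one_le_iff_ne_zero.1 hk.1) hk.2
    (Prod.ext (Circle.ext ?_) (Circle.ext ?_))
  · exact (mul_eq_right₀ hz₁).1 hfix'.1
  · exact (mul_eq_right₀ hz₂).1 hfix'.2

end Rotation

section WeightedRotation

variable (α₁ α₂ : Circle) (w : bidiscAlgebra)

theorem weightedRotation_apply (f : bidiscAlgebra) (z : closedBidisc) :
    (weightedRotation α₁ α₂ w f).1 z = w.1 z * f.1 (rotation α₁ α₂ z) := rfl

theorem weightedRotation_pow_apply (k : ℕ) (f : bidiscAlgebra) (z : closedBidisc) :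
    ((weightedRotation α₁ α₂ w ^ k) f).1 z =
      weightProduct (rotation α₁ α₂) w.1 k z * f.1 ((rotation α₁ α₂)^[k] z) := by
  induction k generalizing f with
  | zero => simp [weightProduct]
  | succ k ih =>
    rw [pow_succ, mul_apply_eq_comp, ih, weightedRotation_apply,
      Function.iterate_succ_apply', weightProduct, weightProduct, Finset.prod_range_succ, mul_assoc]

theorem cofactor_apply (μ : ℂ) (m : ℕ) (f : bidiscAlgebra) (z : closedBidisc) :
    (cofactor (weightedRotation α₁ α₂ w) μ m f).1 z =
      ∑ i ∈ Finset.range m, μ ^ (m - 1 - i) * weightProduct (rotation α₁ α₂) w.1 i z *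
        f.1 ((rotation α₁ α₂)^[i] z) := by
  change evalHom z (cofactor (weightedRotation α₁ α₂ w) μ m f) = _
  simp only [cofactor, sum_apply, smul_apply, map_sum,
    map_smul, smul_eq_mul, mul_assoc]
  exact Finset.sum_congr rfl fun i _ =>
    congrArg (_ * ·) (weightedRotation_pow_apply α₁ α₂ w i f z)

/-- The function `w_n` as an element of the bidisc algebra, obtained as `T ^ n 1`. -/
def iterateWeight (n : ℕ) : bidiscAlgebra := (weightedRotation α₁ α₂ w ^ n) 1

theorem iterateWeight_apply (n : ℕ) (z : closedBidisc) :
    (iterateWeight α₁ α₂ w n).1 z = weightProduct (rotation α₁ α₂) w.1 n z :=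
  (weightedRotation_pow_apply α₁ α₂ w n 1 z).trans (mul_one _)

theorem exists_eq_zero_of_weightProduct_eq_zero {K : Type*} {φ : K → K} {v : K → ℂ} {n : ℕ}
    {t : K} (h : weightProduct φ v n t = 0) : ∃ i, v (φ^[i] t) = 0 :=
  let ⟨i, _, hi⟩ := Finset.prod_eq_zero_iff.1 h
  ⟨i, hi⟩

variable {α₁ α₂ w} {m : ℕ} {μ : ℂ}

theorem algebraMap_sub_iterateWeight_eq_zero {z : closedBidisc}
    (hz : μ ^ m = weightProduct (rotation α₁ α₂) w.1 m z) :
    (algebraMap ℂ bidiscAlgebra (μ ^ m) - iterateWeight α₁ α₂ w m).1 z = 0 :=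
  sub_eq_zero.2 (hz.trans (iterateWeight_apply α₁ α₂ w m z).symm)

theorem weightedRotation_pow_eq_mul (hα : (α₁, α₂) ^ m = 1) :
    weightedRotation α₁ α₂ w ^ m =
      ContinuousLinearMap.mul ℂ bidiscAlgebra (iterateWeight α₁ α₂ w m) := by
  ext f z
  refine (weightedRotation_pow_apply α₁ α₂ w m f z).trans ?_
  rw [rotation_iterate_eq_id hα, id_eq, ← iterateWeight_apply]
  rfl

theorem smul_id_sub_apply_cofactor (hα : (α₁, α₂) ^ m = 1) (f : bidiscAlgebra) :
    (μ • ContinuousLinearMap.id ℂ bidiscAlgebra - weightedRotation α₁ α₂ w)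
      (cofactor (weightedRotation α₁ α₂ w) μ m f) =
        (algebraMap ℂ _ (μ ^ m) - iterateWeight α₁ α₂ w m) * f := by
  have h := algebraMap_sub_mul_cofactor (weightedRotation α₁ α₂ w) μ m
  rw [weightedRotation_pow_eq_mul hα, algebraMap_sub_mul_eq] at h
  exact DFunLike.congr_fun h f

theorem cofactor_apply_smul_id_sub (hα : (α₁, α₂) ^ m = 1) (f : bidiscAlgebra) :
    cofactor (weightedRotation α₁ α₂ w) μ m
      ((μ • ContinuousLinearMap.id ℂ bidiscAlgebra - weightedRotation α₁ α₂ w) f) =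
        (algebraMap ℂ _ (μ ^ m) - iterateWeight α₁ α₂ w m) * f := by
  have h := cofactor_mul_algebraMap_sub (weightedRotation α₁ α₂ w) μ m
  rw [weightedRotation_pow_eq_mul hα, algebraMap_sub_mul_eq] at h
  exact DFunLike.congr_fun h f

theorem spectrum_weightedRotation_subset (hα : (α₁, α₂) ^ m = 1) :
    spectrum ℂ (weightedRotation α₁ α₂ w) ⊆
      {μ | ∃ t, μ ^ m = weightProduct (rotation α₁ α₂) w.1 m t} := by
  intro μ hμ
  have hpow := spectrum.pow_mem_pow _ m hμ
  rw [weightedRotation_pow_eq_mul hα] at hpow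
  obtain ⟨t, ht⟩ := spectrum_mul_subset _ hpow
  exact ⟨t, ht.symm.trans (iterateWeight_apply α₁ α₂ w m t)⟩

theorem approxPointSpectrum_weightedRotation_subset (hα : (α₁, α₂) ^ m = 1) :
    approxPointSpectrum (weightedRotation α₁ α₂ w) ⊆
      {μ | ∃ t ∈ torus, μ ^ m = weightProduct (rotation α₁ α₂) w.1 m t} := by
  intro μ hμ
  have hpow := pow_mem_approxPointSpectrum_pow hμ m
  rw [weightedRotation_pow_eq_mul hα] at hpow
  obtain ⟨t, ht, htμ⟩ := approxPointSpectrum_mul_subset _ hpow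
  exact ⟨t, ht, htμ.symm.trans (iterateWeight_apply α₁ α₂ w m t)⟩

end WeightedRotation

section LowerSemiFredholmSpectrum

variable {α₁ α₂ : Circle} {w : bidiscAlgebra} {m : ℕ}

theorem zero_mem_lowerSemiFredholmSpectrum {s : closedBidisc} (hs : s.1 ∈ openBidisc)
    (hws : w.1 s = 0) : 0 ∈ lowerSemiFredholmSpectrum (weightedRotation α₁ α₂ w) := by
  intro hS
  rw [IsLowerSemiFredholm] at hS
  have hker (z : {z ∈ Set.univ | w.1 z = 0}) :
      ((0 : ℂ) • ContinuousLinearMap.id ℂ bidiscAlgebra - weightedRotation α₁ α₂ w).range ≤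
        (evalHom z).toLinearMap.ker := by
    rintro _ ⟨f, rfl⟩
    change 0 * f.1 z - w.1 z * f.1 (rotation α₁ α₂ z) = 0
    rw [z.2.2, zero_mul, zero_mul, sub_zero]
  exact infinite_zeros isOpen_univ (Set.mem_univ s) hs hws <| Set.finite_coe_iff.1 <|
    finite_of_linearIndependent_of_le_ker
      (linearIndependent_evalHom.comp _ Subtype.val_injective) hker

theorem linearIndependent_evalHom_comp_cofactor [NeZero m] {μ : ℂ} (hμ : μ ≠ 0)
    {Z : Set closedBidisc} (hZ : ∀ z ∈ Z, ∀ i ∈ Finset.Ico 1 m, (rotation α₁ α₂)^[i] z ∉ Z) :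
    LinearIndependent ℂ fun z : Z =>
      (evalHom z).toLinearMap ∘ₗ (cofactor (weightedRotation α₁ α₂ w) μ m).toLinearMap := by
  refine linearIndependent_of_sub_smul_mem_span linearIndependent_evalHom
    (c := fun _ => μ ^ (m - 1)) (fun _ => pow_ne_zero _ hμ) fun z => ?_
  have hsum : (evalHom z).toLinearMap ∘ₗ (cofactor (weightedRotation α₁ α₂ w) μ m).toLinearMap =
      ∑ i ∈ Finset.range m, (μ ^ (m - 1 - i) * weightProduct (rotation α₁ α₂) w.1 i z) •
        (evalHom ((rotation α₁ α₂)^[i] z)).toLinearMap := by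
    ext f
    rw [LinearMap.sum_apply]
    exact cofactor_apply α₁ α₂ w μ m f z
  have hzero : μ ^ (m - 1 - 0) * weightProduct (rotation α₁ α₂) w.1 0 z = μ ^ (m - 1) := by
    simp [weightProduct]
  rw [hsum, Finset.sum_range_eq_add_Ico _ (NeZero.pos m), hzero, Function.iterate_zero, id_eq,
    add_sub_cancel_left]
  exact Submodule.sum_mem _ fun i hi =>
    Submodule.smul_mem _ _ (Submodule.subset_span ⟨_, hZ z z.2 i hi, rfl⟩)

theorem mem_lowerSemiFredholmSpectrum_of_ne_zero [NeZero m] (hα : IsPrimitiveRoot (α₁, α₂) m)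
    {μ : ℂ} (hμ : μ ≠ 0) {s : closedBidisc} (hs : s ∈ puncturedBidisc)
    (hμs : μ ^ m = weightProduct (rotation α₁ α₂) w.1 m s) :
    μ ∈ lowerSemiFredholmSpectrum (weightedRotation α₁ α₂ w) := by
  intro hS
  rw [IsLowerSemiFredholm] at hS
  obtain ⟨V, hV, hsV, hVdisj⟩ := exists_isOpen_forall_iterate_notMem (rotation α₁ α₂).continuous
    fun i hi => rotation_iterate_ne hα hs.2.1 hs.2.2 hi
  let h : bidiscAlgebra := algebraMap ℂ _ (μ ^ m) - iterateWeight α₁ α₂ w m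
  have hhs : h.1 s = 0 := algebraMap_sub_iterateWeight_eq_zero hμs
  have hker (z : {z ∈ V | h.1 z = 0}) :
      (μ • ContinuousLinearMap.id ℂ bidiscAlgebra - weightedRotation α₁ α₂ w).range ≤
        ((evalHom z).toLinearMap ∘ₗ
          (cofactor (weightedRotation α₁ α₂ w) μ m).toLinearMap).ker := by
    rintro _ ⟨f, rfl⟩
    refine (congrArg (evalHom z) (cofactor_apply_smul_id_sub hα.pow_eq_one f)).trans ?_
    exact (map_mul (evalHom z) h f).trans (mul_eq_zero_of_left z.2.2 _)
  have hindep := linearIndependent_evalHom_comp_cofactor (α₁ := α₁) (α₂ := α₂) (w := w) hμ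
    (Z := {z ∈ V | h.1 z = 0}) fun z hz i hi hiz => hVdisj z hz.1 i hi hiz.1
  exact infinite_zeros hV hsV hs.1 hhs <| Set.finite_coe_iff.1 <|
    finite_of_linearIndependent_of_le_ker hindep hker

theorem subset_lowerSemiFredholmSpectrum [NeZero m] (hα : IsPrimitiveRoot (α₁, α₂) m) :
    {μ | ∃ t, μ ^ m = weightProduct (rotation α₁ α₂) w.1 m t} ⊆
      lowerSemiFredholmSpectrum (weightedRotation α₁ α₂ w) := by
  have hcont : Continuous (weightProduct (rotation α₁ α₂) w.1 m) :=
    continuous_finsetProd _ fun i _ => w.1.continuous.comp ((rotation α₁ α₂).continuous.iterate i)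
  refine (setOf_pow_eq_subset_closure m hcont dense_puncturedBidisc).trans <|
    (isClosed_lowerSemiFredholmSpectrum _).closure_subset_iff.2 ?_
  rintro μ ⟨s, hs, hμs⟩
  obtain rfl | hμ := eq_or_ne μ 0
  · rw [zero_pow (NeZero.ne m)] at hμs
    obtain ⟨i, hi⟩ := exists_eq_zero_of_weightProduct_eq_zero hμs.symm
    exact zero_mem_lowerSemiFredholmSpectrum (rotation_iterate_mem_openBidisc hs.1 i) hi
  · exact mem_lowerSemiFredholmSpectrum_of_ne_zero hα hμ hs hμs

end LowerSemiFredholmSpectrum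

section SemiFredholmSpectrum

variable {α₁ α₂ : Circle} {w : bidiscAlgebra} {m : ℕ} {t : closedBidisc}

theorem norm_pow_le_one_of_isPeakFunction {g : bidiscAlgebra} (hg : IsPeakFunction g.1 t) (n : ℕ) :
    ‖g ^ n‖ ≤ 1 :=
  (ContinuousMap.norm_le _ zero_le_one).2 fun z =>
    (norm_pow (g.1 z) n).trans_le (pow_le_one₀ (norm_nonneg _) (hg.norm_le_one z))

theorem tendsto_mul_pow_of_isPeakFunction {h g : bidiscAlgebra} (hg : IsPeakFunction g.1 t)
    (ht : h.1 t = 0) : Tendsto (fun n => h * g ^ n) atTop (𝓝 0) :=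
  tendsto_subtype_rng.2 (hg.tendsto_mul_pow ht)

theorem not_isUpperSemiFredholm_zero_smul_sub (ht : t ∈ torus) (hwt : w.1 t = 0) :
    ¬ IsUpperSemiFredholm
      ((0 : ℂ) • ContinuousLinearMap.id ℂ bidiscAlgebra - weightedRotation α₁ α₂ w) := by
  intro hS
  obtain ⟨g, hg⟩ := exists_isPeakFunction (rotation_iterate_mem_torus (α₁ := α₁) (α₂ := α₂) ht 1)
  have hgΦ : IsPeakFunction (compRotation α₁ α₂ g).1 t := hg.comp rotation_injective
  have hlim : Tendsto (fun n => ((0 : ℂ) • ContinuousLinearMap.id ℂ bidiscAlgebra -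
      weightedRotation α₁ α₂ w) (g ^ n)) atTop (𝓝 0) := by
    refine (tendsto_mul_pow_of_isPeakFunction (h := -w) hgΦ (neg_eq_zero.2 hwt)).congr fun n => ?_
    change -w * compRotation α₁ α₂ (g ^ n) = (0 : ℂ) • g ^ n - w * compRotation α₁ α₂ (g ^ n)
    rw [zero_smul, zero_sub]
    exact neg_mul w _
  have hcont := hS.continuous_of_tendsto (norm_pow_le_one_of_isPeakFunction hg) hlim hg.tendsto_pow
  have hzero := eq_of_forall_notMem_finite hcont (continuous_const (y := 0))
    (Set.finite_singleton _) fun z hz => Set.indicator_of_notMem hz 1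
  simpa using congrFun hzero (rotation α₁ α₂ t)

theorem not_isUpperSemiFredholm_smul_sub_of_ne_zero [NeZero m] (hα : IsPrimitiveRoot (α₁, α₂) m)
    {μ : ℂ} (hμ : μ ≠ 0) (ht : t ∈ torus)
    (hμt : μ ^ m = weightProduct (rotation α₁ α₂) w.1 m t) :
    ¬ IsUpperSemiFredholm
      (μ • ContinuousLinearMap.id ℂ bidiscAlgebra - weightedRotation α₁ α₂ w) := by
  intro hS
  obtain ⟨g, hg⟩ := exists_isPeakFunction ht
  set R := cofactor (weightedRotation α₁ α₂ w) μ m with hR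
  have hbound (n : ℕ) : ‖R (g ^ n)‖ ≤ ‖R‖ * 1 :=
    R.le_of_opNorm_le_of_le le_rfl (norm_pow_le_one_of_isPeakFunction hg n)
  have hlim : Tendsto (fun n => (μ • ContinuousLinearMap.id ℂ bidiscAlgebra -
      weightedRotation α₁ α₂ w) (R (g ^ n))) atTop (𝓝 0) := by
    simp only [hR, smul_id_sub_apply_cofactor hα.pow_eq_one]
    exact tendsto_mul_pow_of_isPeakFunction hg (algebraMap_sub_iterateWeight_eq_zero hμt)
  have hpointwise (z : closedBidisc) : Tendsto (fun n => (R (g ^ n)).1 z) atTop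
      (𝓝 (∑ i ∈ Finset.range m, μ ^ (m - 1 - i) * weightProduct (rotation α₁ α₂) w.1 i z *
        ({t} : Set closedBidisc).indicator 1 ((rotation α₁ α₂)^[i] z))) := by
    simp only [hR, cofactor_apply]
    exact tendsto_finsetSum _ fun i _ => (hg.tendsto_pow _).const_mul _
  refine not_continuous_sum_indicator_iterate rotation_injective
    (fun i hi => rotation_iterate_ne hα (fst_ne_zero_of_mem_torus ht)
      (snd_ne_zero_of_mem_torus ht) hi) ?_ (hS.continuous_of_tendsto hbound hlim hpointwise)
  simpa [weightProduct] using pow_ne_zero (m - 1) hμ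

theorem subset_semiFredholmSpectrum [NeZero m] (hα : IsPrimitiveRoot (α₁, α₂) m) :
    {μ | ∃ t ∈ torus, μ ^ m = weightProduct (rotation α₁ α₂) w.1 m t} ⊆
      semiFredholmSpectrum (weightedRotation α₁ α₂ w) := by
  rintro μ ⟨t, ht, hμt⟩
  refine not_or.2 ⟨?_, subset_lowerSemiFredholmSpectrum hα ⟨t, hμt⟩⟩
  obtain rfl | hμ := eq_or_ne μ 0
  · rw [zero_pow (NeZero.ne m)] at hμt
    obtain ⟨i, hi⟩ := exists_eq_zero_of_weightProduct_eq_zero hμt.symm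
    exact not_isUpperSemiFredholm_zero_smul_sub (rotation_iterate_mem_torus ht i) hi
  · exact not_isUpperSemiFredholm_smul_sub_of_ne_zero hα hμ ht hμt

end SemiFredholmSpectrum

end Bidisc

end

open Bidisc in
theorem mainTheorem11 (α₁ α₂ : Circle) (p q : ℕ) (hp : 0 < p) (hq : 0 < q)
    (hα₁ : IsPrimitiveRoot (α₁ : ℂ) p) (hα₂ : IsPrimitiveRoot (α₂ : ℂ) q)
    (w : Bidisc.bidiscAlgebra) :
    (spectrum ℂ (Bidisc.weightedRotation α₁ α₂ w) =
        Bidisc.lowerSemiFredholmSpectrum (Bidisc.weightedRotation α₁ α₂ w) ∧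
      Bidisc.lowerSemiFredholmSpectrum (Bidisc.weightedRotation α₁ α₂ w) =
        {μ : ℂ | ∃ t : Bidisc.closedBidisc,
          μ ^ Nat.lcm p q =
            Bidisc.weightProduct (Bidisc.rotation α₁ α₂) w.1 (Nat.lcm p q) t}) ∧
    (Bidisc.approxPointSpectrum (Bidisc.weightedRotation α₁ α₂ w) =
        Bidisc.semiFredholmSpectrum (Bidisc.weightedRotation α₁ α₂ w) ∧
      Bidisc.semiFredholmSpectrum (Bidisc.weightedRotation α₁ α₂ w) =
        {μ : ℂ | ∃ t ∈ Bidisc.torus,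
          μ ^ Nat.lcm p q =
            Bidisc.weightProduct (Bidisc.rotation α₁ α₂) w.1 (Nat.lcm p q) t}) := by
  have hα : IsPrimitiveRoot (α₁, α₂) (p.lcm q) := isPrimitiveRoot_prodMk
    (.of_map_of_injective (f := Circle.coeHom) hα₁ Circle.coe_injective)
    (.of_map_of_injective (f := Circle.coeHom) hα₂ Circle.coe_injective)
  have : NeZero (p.lcm q) := ⟨(Nat.lcm_pos hp hq).ne'⟩
  have hspec := spectrum_weightedRotation_subset (w := w) hα.pow_eq_one
  have hlsf := subset_lowerSemiFredholmSpectrum (w := w) hα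
  have hlsf_spec := lowerSemiFredholmSpectrum_subset_spectrum (weightedRotation α₁ α₂ w)
  have hap := approxPointSpectrum_weightedRotation_subset (w := w) hα.pow_eq_one
  have hsf := subset_semiFredholmSpectrum (w := w) hα
  have hsf_ap := semiFredholmSpectrum_subset_approxPointSpectrum (weightedRotation α₁ α₂ w)
  exact ⟨⟨(hspec.trans hlsf).antisymm hlsf_spec, (hlsf_spec.trans hspec).antisymm hlsf⟩,
    (hap.trans hsf).antisymm hsf_ap, (hsf_ap.trans hap).antisymm hsf⟩
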